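/- Let $L$ be a countable first-order language and let $T$ be a complete $L$-theory that is $\omega$-categorical, i.e. any two models of $T$ of cardinality $\aleph_0$ are isomorphic. Formulas are first-order $L$-formulas without parameters, and two formulas are $T$-equivalent if they are equivalent in every model of $T$. For $n\ge 0$, a formula is an $n$-formula of $T$ if it is $T$-equivalent to a Boolean combination of formulas each having at most $n$ free variables. The theory $T$ is $1$-ary if every formula is $T$-equivalent to a Boolean combination of formulas with at most one free variable and of formulas $x\approx y$; for $n\ge 2$, $T$ is $n$-ary if every formula is an $n$-formula of $T$. For $n\ge 1$, $T$ is almost $n$-ary if there are finitely many formulas $\varphi_1,\dots,\varphi_m$ ($m\ge 0$) such that every formula is $T$-equivalent to a Boolean combination of $n$-formulas of $T$ and of formulas obtained from $\varphi_1,\dots,\varphi_m$ by substituting variables (not necessarily distinct) for their free variables. Let $\mathrm{ar}(T)$ be the least $n\ge 1$ such that $T$ is $n$-ary, and $\mathrm{ar}(T)=\infty$ if there is no such $n$; let $\mathrm{aar}(T)$ be the least $n\ge 1$ such that $T$ is almost $n$-ary, and $\mathrm{aar}(T)=\infty$ if there is no such $n$. Then either $\mathrm{aar}(T)=1$ and $\mathrm{ar}(T)$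 is finite, or $\mathrm{aar}(T)=\mathrm{ar}(T)=\infty$. -/

import Mathlib

open FirstOrder Cardinal

universe u v w

namespace AlmostArity

open FirstOrder.Language

variable {L : FirstOrder.Language.{u, v}}

/-- Boolean combinations of members of a set `Δ` of first-order formulas. Formulas are written in the
countably many variables `x₀, x₁, …`, indexed by `ℕ`. -/
inductive BoolComb (Δ : Set (L.Formula ℕ)) : L.Formula ℕ → Prop
  | of {φ : L.Formula ℕ} : φ ∈ Δ → BoolComb Δ φ
  | bot : BoolComb Δ ⊥
  | top : BoolComb Δ ⊤
  | not {φ : L.Formula ℕ} : BoolComb Δ φ → BoolComb Δ φ.not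
  | and {φ ψ : L.Formula ℕ} : BoolComb Δ φ → BoolComb Δ ψ → BoolComb Δ (φ ⊓ ψ)
  | or {φ ψ : L.Formula ℕ} : BoolComb Δ φ → BoolComb Δ ψ → BoolComb Δ (φ ⊔ ψ)

/-- `φ` is equivalent, modulo the theory `T`, to a Boolean combination of formulas in `Δ`. -/
def ReducesTo (T : L.Theory) (Δ : Set (L.Formula ℕ)) (φ : L.Formula ℕ) : Prop :=
  ∃ ψ : L.Formula ℕ, BoolComb Δ ψ ∧ T.Iff φ ψ

/-- The formulas with (at most) `n` free variables. A formula with fewer than `n` free variables is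
one with `n` free variables after adding trivial conjuncts `x ≈ x`. -/
def formulasOfArity (L : FirstOrder.Language.{u, v}) (n : ℕ) : Set (L.Formula ℕ) :=
  {φ | (BoundedFormula.freeVarFinset φ).card ≤ n}

/-- The formulas `x ≈ y`, for variables `x` and `y`. -/
def equalities (L : FirstOrder.Language.{u, v}) : Set (L.Formula ℕ) :=
  {φ | ∃ i j : ℕ, φ = Term.equal (Term.var i) (Term.var j)}

/-- `φ` is an `n`-ary formula of `T` (an `n`-formula): it is `T`-equivalent to a Boolean
combination of formulas with `n` free variables. -/
def IsNFormula (T : L.Theory) (n : ℕ) (φ : L.Formula ℕ) : Prop :=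
  ReducesTo T (formulasOfArity L n) φ

/-- `T` is unary: every formula is `T`-equivalent to a Boolean combination of formulas with one free
variable and of equalities of variables. -/
def IsUnary (T : L.Theory) : Prop :=
  ∀ φ : L.Formula ℕ, ReducesTo T (formulasOfArity L 1 ∪ equalities L) φ

/-- `T` is `n`-ary (meaningful for `n ≥ 1`): unary when `n = 1`, and for `n ≥ 2` every formula is an
`n`-formula. -/
def IsNAry (T : L.Theory) (n : ℕ) : Prop :=
  if n = 1 then IsUnary T else ∀ φ : L.Formula ℕ, IsNFormula T n φ

/-- The formulas obtained from members of `W` by substituting variables for the free variables; the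
substitution may identify variables. -/
def substitutions (W : Set (L.Formula ℕ)) : Set (L.Formula ℕ) :=
  {χ | ∃ φ ∈ W, ∃ σ : ℕ → ℕ, χ = φ.relabel σ}

/-- `T` is almost `n`-ary: there is a finite set `W` of formulas such that every formula is
`T`-equivalent to a Boolean combination of `n`-formulas and of formulas obtained from members of `W`
by substitution of free variables. -/
def IsAlmostNAry (T : L.Theory) (n : ℕ) : Prop :=
  ∃ W : Finset (L.Formula ℕ), ∀ φ : L.Formula ℕ,
    ReducesTo T ({χ | IsNFormula T n χ} ∪ substitutions (W : Set (L.Formula ℕ))) φ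

/-- `ar(T)`: the least `n ≥ 1` such that `T` is `n`-ary, and `∞` if there is none. (An `n`-ary theory
is `k`-ary for all `k ≥ n`, see `IsNAry.mono`, so this is the unique `n` such that `T` is `n`-ary and
not `(n-1)`-ary.) -/
noncomputable def ar (T : L.Theory) : ℕ∞ :=
  sInf {N : ℕ∞ | ∃ n : ℕ, N = n ∧ 1 ≤ n ∧ IsNAry T n}

/-- `aar(T)`: the least `n ≥ 1` such that `T` is almost `n`-ary, and `∞` if there is none. -/
noncomputable def aar (T : L.Theory) : ℕ∞ :=
  sInf {N : ℕ∞ | ∃ n : ℕ, N = n ∧ 1 ≤ n ∧ IsAlmostNAry T n}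

theorem BoolComb.mono {Δ Γ : Set (L.Formula ℕ)} (h : Δ ⊆ Γ) {φ : L.Formula ℕ}
    (hφ : BoolComb Δ φ) : BoolComb Γ φ := by
  induction hφ with
  | of h' => exact .of (h h')
  | bot => exact .bot
  | top => exact .top
  | not _ ih => exact .not ih
  | and _ _ ih₁ ih₂ => exact .and ih₁ ih₂
  | or _ _ ih₁ ih₂ => exact .or ih₁ ih₂

theorem equalities_subset {n : ℕ} (hn : 2 ≤ n) : equalities L ⊆ formulasOfArity L n := by
  rintro φ ⟨i, j, rfl⟩
  refine le_trans ?_ hn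
  simp only [Term.equal, Term.bdEqual, BoundedFormula.freeVarFinset, Term.relabel]
  refine (Finset.card_union_le _ _).trans ?_
  simp [Term.varFinsetLeft]

/-- Arities are monotone. -/
theorem IsNAry.mono {T : L.Theory} {n k : ℕ} (hn : 1 ≤ n) (hnk : n ≤ k) (h : IsNAry T n) :
    IsNAry T k := by
  rcases hnk.eq_or_lt with rfl | hlt
  · exact h
  have hk : k ≠ 1 := by omega
  have hmono : formulasOfArity L n ⊆ formulasOfArity L k := fun φ hφ => le_trans hφ hnk
  simp only [IsNAry, hk, if_false]
  intro φ
  by_cases h1 : n = 1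
  · subst h1
    obtain ⟨ψ, hψ, e⟩ := (show IsUnary T by simpa [IsNAry] using h) φ
    exact ⟨ψ, hψ.mono (Set.union_subset hmono (equalities_subset hlt)), e⟩
  · simp only [IsNAry, h1, if_false] at h
    obtain ⟨ψ, hψ, e⟩ := h φ
    exact ⟨ψ, hψ.mono hmono, e⟩

end AlmostArity

/-! It suffices that `ar T` is finite as soon as `T` is almost `n`-ary for some `n`, and that `T` is
then almost unary. For the former, substituting variables never increases the number of free
variables, so the finitely many extra formulas have bounded arity (`IsAlmostNAry.exists_isNAry`).
For the latter, let `T` be `m`-ary. By Ryll-Nardzewski (`IsComplete.exists_finset_isolating`),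
finitely many isolating formulas cover all `(m+1)`-tuples, so each formula with at most `m+1` free
variables is a disjunction of substitution instances of them. These formulas alone witness almost
unarity (`IsNAry.isAlmostNAry_one`). -/

/-! ### Compactness, generic types and omitting types. -/

namespace FirstOrder.Language.Theory

variable {L : FirstOrder.Language.{u, v}} {T : L.Theory}

/-- Whether a formula holds depends only on the values of its free variables. -/
theorem realize_congr_of_eqOn_freeVarFinset {α : Type*} [DecidableEq α] {M : Type w}
    [L.Structure M] {φ : L.Formula α} {v v' : α → M}
    (h : ∀ a ∈ BoundedFormula.freeVarFinset φ, v a = v' a) : φ.Realize v ↔ φ.Realize v' :=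
  (BoundedFormula.realize_restrictFreeVar (f := id) (v := fun a => v a) v fun _ => rfl).symm.trans
    (BoundedFormula.realize_restrictFreeVar (f := id) v' fun a => h a a.2)

/-- Compactness for sets of formulas with free variables, over a theory. -/
theorem exists_realize_of_finitely_realized {α : Type} (Γ : Set (L.Formula α))
    (h : ∀ s : Finset (L.Formula α), (s : Set (L.Formula α)) ⊆ Γ →
      ∃ (M : ModelType.{u, v, max u v} T) (v : α → M), ∀ φ ∈ s, φ.Realize v) :
    ∃ (M : ModelType.{u, v, max u v} T) (v : α → M), ∀ φ ∈ Γ, φ.Realize v := by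
  -- The variables become new constants, reducing the claim to compactness for sentences.
  have hsat : ((L.lhomWithConstants α).onTheory T ∪
      Formula.equivSentence '' Γ).IsSatisfiable := by
    rw [isSatisfiable_iff_isFinitelySatisfiable]
    intro T0 hT0
    classical
    obtain ⟨M, v, hv⟩ := h ((T0.image Formula.equivSentence.symm).filter (· ∈ Γ))
      (by intro φ hφ; exact (Finset.mem_filter.1 hφ).2)
    let : (constantsOn α).Structure M := constantsOn.structure v
    have hM : M ⊨ (L.lhomWithConstants α).onTheory T :=
      (LHom.onTheory_model _ _).2 inferInstance
    have : M ⊨ (T0 : L[[α]].Theory) := by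
      refine ⟨fun ψ hψ => ?_⟩
      rcases hT0 hψ with h' | ⟨φ, hφ, rfl⟩
      · exact hM.realize_of_mem ψ h'
      · refine (Formula.realize_equivSentence _ _).2 (hv φ ?_)
        rw [Finset.mem_filter, Finset.mem_image]
        exact ⟨⟨_, hψ, by simp⟩, hφ⟩
    exact Model.isSatisfiable M
  obtain ⟨M⟩ := hsat
  let := (L.lhomWithConstants α).reduct M
  have : (L.lhomWithConstants α).IsExpansionOn M := LHom.isExpansionOn_reduct _ _
  have : M ⊨ T := (LHom.onTheory_model (L.lhomWithConstants α) T).1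
    (M.is_model.mono Set.subset_union_left)
  refine ⟨ModelType.of T M, fun a => (L.con a : M), fun φ hφ => ?_⟩
  refine (Formula.realize_equivSentence (M : Type _) φ).1 (M.is_model.realize_of_mem _ ?_)
  exact Or.inr ⟨φ, hφ, rfl⟩

variable (T) in
/-- The formula `φ` is realized in some model of `T`. -/
def Consistent {α : Type} (φ : L.Formula α) : Prop :=
  ∃ (M : ModelType.{u, v, max u v} T) (v : α → M), φ.Realize v

/-- A countable family of dense sets of consistent formulas is met by the type of some tuple. -/
theorem exists_generic {α : Type} {ι : Type*} [Countable ι] (hT : T.IsSatisfiable)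
    (D : ι → Set (L.Formula α))
    (hD : ∀ i θ, T.Consistent θ → ∃ θ' ∈ D i, T.Consistent θ' ∧ θ' ⟹[T] θ) :
    ∃ (M : ModelType.{u, v, max u v} T) (v : α → M), ∀ i, ∃ θ ∈ D i, θ.Realize v := by
  let : Encodable ι := Encodable.ofCountable ι
  -- Stronger formulas are larger, so density is cofinality and one increasing sequence meets every
  -- `D i`.
  let : Preorder {θ : L.Formula α // T.Consistent θ} :=
    { le := fun θ θ' => θ'.1 ⟹[T] θ.1
      le_refl := fun θ => Imp.refl _
      le_trans := fun _ _ _ h₁ h₂ => h₂.trans h₁ }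
  let C : ι → Order.Cofinal {θ : L.Formula α // T.Consistent θ} := fun i =>
    { carrier := {θ | θ.1 ∈ D i}
      isCofinal := fun θ => by
        obtain ⟨θ', h₁, h₂, h₃⟩ := hD i θ.1 θ.2
        exact ⟨⟨θ', h₂⟩, h₁, h₃⟩ }
  have htop : T.Consistent (⊤ : L.Formula α) :=
    ⟨hT.some, fun _ => Classical.arbitrary _, BoundedFormula.realize_top.2 trivial⟩
  let s := Order.sequenceOfCofinals ⟨⊤, htop⟩ C
  have hs : Monotone s := Order.sequenceOfCofinals.monotone _ C
  obtain ⟨M, v, hv⟩ := exists_realize_of_finitely_realized (T := T)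
    (Set.range fun k => (s k).1) (fun t ht => by
      have hbound : ∃ k, ∀ φ ∈ t, (s k).1 ⟹[T] φ := by
        classical
        choose! f hf using fun φ (hφ : φ ∈ t) => ht hφ
        refine ⟨t.sup f, fun φ hφ => ?_⟩
        have := hs (Finset.le_sup (f := f) hφ)
        rw [← hf φ hφ]
        exact this
      obtain ⟨k, hk⟩ := hbound
      obtain ⟨M, v, hv⟩ := (s k).2
      exact ⟨M, v, fun φ hφ => (hk φ hφ).realize_formula M hv⟩)
  exact ⟨M, v, fun i => ⟨_, Order.sequenceOfCofinals.encode_mem _ C i, hv _ ⟨_, rfl⟩⟩⟩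

/-- If every instance of a formula with parameters in the range of `v` that has a solution has a
solution in the range of `v`, then this range is an elementary substructure. -/
theorem exists_elementarySubstructure_eq_range {M : Type w} [L.Structure M] (v : ℕ → M)
    (hv : ∀ φ : L.Formula (Option ℕ), (∃ a, φ.Realize fun o => o.elim a v) →
      ∃ j, φ.Realize fun o => o.elim (v j) v) :
    ∃ S : L.ElementarySubstructure M, (S : Set M) = Set.range v := by
  have hS : ∀ x ∈ Substructure.closure L (Set.range v), x ∈ Set.range v := by
    intro x hx
    obtain ⟨t, rfl⟩ := Substructure.mem_closure_iff_exists_term.1 hx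
    choose f hf using fun y : Set.range v => y.2
    obtain ⟨j, hj⟩ := hv ((Term.var none).equal (t.relabel fun y => some (f y)))
      ⟨t.realize (↑), by simp [Function.comp_def, hf]⟩
    refine ⟨j, ?_⟩
    simpa [Function.comp_def, hf] using hj
  refine ⟨(Substructure.closure L (Set.range v)).toElementarySubstructure ?_, ?_⟩
  · intro n φ x a ha
    choose k hk using fun i => hS (x i) (x i).2
    let g : Empty ⊕ Fin (n + 1) → Option ℕ :=
      Sum.elim Empty.elim (Fin.snoc (fun i => some (k i)) none : Fin (n + 1) → Option ℕ)
    have key : ∀ b : M, (φ.toFormula.relabel g).Realize (fun o => o.elim b v) ↔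
        φ.Realize default (Fin.snoc ((↑) ∘ x) b : _ → M) := by
      intro b
      rw [Formula.realize_relabel, BoundedFormula.realize_toFormula]
      have h₁ : ((fun o : Option ℕ => o.elim b v) ∘ g) ∘ Sum.inl = (default : Empty → M) :=
        Subsingleton.elim _ _
      have h₂ : ((fun o : Option ℕ => o.elim b v) ∘ g) ∘ Sum.inr =
          (Fin.snoc ((↑) ∘ x) b : Fin (n + 1) → M) := by
        funext i
        refine Fin.lastCases ?_ (fun i => ?_) i
        · simp [g]
        · simp [g, hk]
      rw [h₁, h₂]
    obtain ⟨j, hj⟩ := hv (φ.toFormula.relabel g) ⟨a, (key a).2 ha⟩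
    exact ⟨⟨v j, Substructure.subset_closure ⟨j, rfl⟩⟩, (key _).1 hj⟩
  · exact Set.Subset.antisymm hS Substructure.subset_closure

/-- The omitting types theorem for partial types in finitely many variables. -/
theorem exists_countable_model_omitting [Countable L.Symbols] (hT : T.IsSatisfiable) {n : ℕ}
    (p : Set (L.Formula (Fin n)))
    (hp : ∀ χ : L.Formula (Fin n), T.Consistent χ → ∃ φ ∈ p, T.Consistent (χ ⊓ φ.not)) :
    ∃ M : ModelType.{u, v, max u v} T, Countable M ∧
      ∀ v : Fin n → M, ∃ φ ∈ p, ¬ φ.Realize v := by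
  classical
  -- Two kinds of requirement: a Henkin witness for each `φ`, and for each choice `σ` of `n`
  -- variables, the failure of some member of `p`.
  let D : L.Formula (Option ℕ) ⊕ (Fin n → ℕ) → Set (L.Formula ℕ) :=
    Sum.elim
      (fun φ => {θ | ∃ j, ∀ (M : ModelType.{u, v, max u v} T) (v : ℕ → M), θ.Realize v →
        (∃ a, φ.Realize fun o => o.elim a v) → φ.Realize fun o => o.elim (v j) v})
      (fun σ => {θ | ∃ φ ∈ p, θ ⟹[T] (φ.relabel σ).not})
  obtain ⟨M, v, hv⟩ := exists_generic hT D (by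
    rintro (φ | σ) θ ⟨M, v, hθ⟩
    -- A fresh variable `j` can be given the witness as its value without affecting `θ` or `φ`.
    · obtain ⟨j, hj⟩ := Infinite.exists_notMem_finset
        (θ.freeVarFinset ∪ (φ.freeVarFinset.image fun o => o.getD 0))
      rw [Finset.mem_union, not_or] at hj
      have hθj : ∀ (N : ModelType.{u, v, max u v} T) (v : ℕ → N) (a : N),
          θ.Realize (Function.update v j a) ↔ θ.Realize v := by
        intro N v a
        refine realize_congr_of_eqOn_freeVarFinset fun b hb => Function.update_of_ne ?_ _ _
        rintro rfl
        exact hj.1 hb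
      have hφj : ∀ (N : ModelType.{u, v, max u v} T) (v : ℕ → N) (a b : N),
          φ.Realize (fun o => o.elim b (Function.update v j a)) ↔
            φ.Realize (fun o => o.elim b v) := by
        intro N v a b
        refine realize_congr_of_eqOn_freeVarFinset fun o ho => ?_
        cases o with
        | none => rfl
        | some k =>
          refine Function.update_of_ne ?_ _ _
          rintro rfl
          exact hj.2 (Finset.mem_image.2 ⟨_, ho, rfl⟩)
      let ex : L.Formula ℕ := Formula.iExs (Fin 1) (φ.relabel fun o => o.elim (Sum.inr 0) Sum.inl)
      have hex : ∀ (N : ModelType.{u, v, max u v} T) (v : ℕ → N),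
          ex.Realize v ↔ ∃ a, φ.Realize fun o => o.elim a v := by
        intro N v
        rw [Formula.realize_iExs]
        simp only [Formula.realize_relabel]
        refine ⟨fun ⟨a, ha⟩ => ⟨a 0, ?_⟩, fun ⟨a, ha⟩ => ⟨fun _ => a, ?_⟩⟩ <;>
        · convert ha using 1
          funext o
          cases o <;> rfl
      let wit : L.Formula ℕ := φ.relabel fun o => o.elim j id
      have hwit : ∀ (N : ModelType.{u, v, max u v} T) (v : ℕ → N),
          wit.Realize v ↔ φ.Realize fun o => o.elim (v j) v := by
        intro N v
        rw [Formula.realize_relabel]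
        refine iff_of_eq (congrArg _ ?_)
        funext o
        cases o <;> rfl
      refine ⟨θ ⊓ ex.imp wit, ⟨j, fun N v h h' => ?_⟩, ?_, fun N v xs => ?_⟩
      · rw [Formula.realize_inf, Formula.realize_imp] at h
        exact (hwit N v).1 (h.2 ((hex N v).2 h'))
      · by_cases ha : ∃ a, φ.Realize fun o => o.elim a v
        · obtain ⟨a, ha⟩ := ha
          refine ⟨M, Function.update v j a, ?_⟩
          rw [Formula.realize_inf, Formula.realize_imp, hθj, hwit, hφj]
          exact ⟨hθ, fun _ => by simpa using ha⟩
        · refine ⟨M, v, ?_⟩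
          rw [Formula.realize_inf, Formula.realize_imp, hex]
          exact ⟨hθ, fun h => (ha h).elim⟩
      · simp only [BoundedFormula.realize_imp, BoundedFormula.realize_inf]
        exact fun h => h.1
    · let β := (θ.freeVarFinset ∪ Finset.univ.image σ : Finset ℕ)
      let θ' : L.Formula β := θ.restrictFreeVar fun x => ⟨x, Finset.mem_union_left _ x.2⟩
      have hθ' : ∀ (N : ModelType.{u, v, max u v} T) (v : ℕ → N),
          θ'.Realize (fun x => v x) ↔ θ.Realize v := fun N v =>
        BoundedFormula.realize_restrictFreeVar v fun _ => rfl
      let τ : Fin n → β := fun i =>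
        ⟨σ i, Finset.mem_union_right _ (Finset.mem_image_of_mem _ (Finset.mem_univ _))⟩
      -- `χ` says what `θ` imposes on the variables chosen by `σ`; equations are used because `σ`
      -- may repeat variables.
      let χ : L.Formula (Fin n) := Formula.iExs β (θ'.relabel Sum.inr ⊓
        Formula.iInf fun i : Fin n => (Term.var (Sum.inl i)).equal (Term.var (Sum.inr (τ i))))
      have hχ : ∀ (N : ModelType.{u, v, max u v} T) (y : Fin n → N),
          χ.Realize y ↔ ∃ x : β → N, θ'.Realize x ∧ y = x ∘ τ := by
        intro N y
        simp [χ, Formula.realize_iExs, Formula.realize_inf, Formula.realize_relabel, funext_iff]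
      obtain ⟨φ, hφ, N, y, hy⟩ := hp χ ⟨M, v ∘ σ, (hχ _ _).2 ⟨fun x => v x, (hθ' M v).2 hθ, rfl⟩⟩
      rw [Formula.realize_inf, hχ, Formula.realize_not] at hy
      obtain ⟨⟨x, hx, rfl⟩, hy⟩ := hy
      let x' : ℕ → N := Function.extend Subtype.val x fun _ => Classical.arbitrary N
      have hx' : ∀ b : β, x' b = x b := fun b => Subtype.val_injective.extend_apply _ _ b
      refine ⟨θ ⊓ (φ.relabel σ).not, ⟨φ, hφ, fun N v xs => ?_⟩, ⟨N, x', ?_⟩, fun N v xs => ?_⟩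
      · simp only [BoundedFormula.realize_imp, BoundedFormula.realize_inf]
        exact fun h => h.2
      · rw [Formula.realize_inf, Formula.realize_not, Formula.realize_relabel, ← hθ']
        have h₁ : (fun b : β => x' b) = x := funext hx'
        have h₂ : x' ∘ σ = x ∘ τ := funext fun i => hx' (τ i)
        rw [h₁, h₂]
        exact ⟨hx, hy⟩
      · simp only [BoundedFormula.realize_imp, BoundedFormula.realize_inf]
        exact fun h => h.1)
  obtain ⟨S, hS⟩ := exists_elementarySubstructure_eq_range (L := L) v (fun φ => by
    obtain ⟨θ, ⟨j, hj⟩, hθ⟩ := hv (Sum.inl φ)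
    exact fun h => ⟨j, hj M v hθ h⟩)
  have hSM : S ⊨ T := inferInstance
  refine ⟨ModelType.of T S, ?_, fun (y : Fin n → S) => ?_⟩
  · change Countable (S : Set M)
    rw [hS]
    exact Set.countable_range v
  · have hy : ∀ i, S.subtype (y i) ∈ Set.range v := fun i => hS ▸ (y i).2
    choose σ hσ using hy
    obtain ⟨θ, ⟨φ, hφ, h⟩, hθ⟩ := hv (Sum.inr σ)
    refine ⟨φ, hφ, fun hreal => ?_⟩
    have h' := h.realize_formula M (v := v)
    rw [Formula.realize_imp, Formula.realize_not, Formula.realize_relabel] at h'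
    refine h' hθ ?_
    rw [show v ∘ σ = S.subtype ∘ y from funext hσ]
    exact (S.subtype.map_formula φ y).2 hreal

end FirstOrder.Language.Theory

/-! ### Isolated types and the Ryll-Nardzewski theorem. -/

namespace FirstOrder.Language.Theory

variable {L : FirstOrder.Language.{u, v}} {T : L.Theory}

variable (T) in
/-- The formula `χ` decides every formula in the same variables, modulo `T`. -/
def Isolating {α : Type} (χ : L.Formula α) : Prop :=
  ∀ φ : L.Formula α, χ ⟹[T] φ ∨ χ ⟹[T] φ.not

/-- The universal closure of the implication is a single sentence, on which all models of a complete
theory agree. -/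
theorem IsComplete.imp_of_forall_realize (hT : T.IsComplete) {α : Type} [Finite α]
    {φ ψ : L.Formula α} (M : ModelType.{u, v, max u v} T)
    (h : ∀ x : α → M, φ.Realize x → ψ.Realize x) : φ ⟹[T] ψ := by
  let σ : L.Sentence := Formula.iAlls α ((φ.imp ψ).relabel Sum.inr)
  have hσ : ∀ N : ModelType.{u, v, max u v} T,
      N ⊨ σ ↔ ∀ x : α → N, φ.Realize x → ψ.Realize x := by
    intro N
    simp [σ, Sentence.Realize, Formula.realize_iAlls, Formula.realize_relabel,
      Formula.realize_imp]
  refine models_formula_iff.2 fun N x => Formula.realize_imp.2 ((hσ N).1 ?_ x)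
  exact ((hT.models_elementarily_equivalent M N).realize_sentence σ).1 ((hσ M).2 h)

/-- Tuples in finite models of a complete theory have isolated types. -/
theorem IsComplete.exists_isolating_of_finite (hT : T.IsComplete) {α : Type} [Finite α]
    (M : ModelType.{u, v, max u v} T) [Finite M] (x : α → M) :
    ∃ χ : L.Formula α, T.Isolating χ ∧ χ.Realize x := by
  -- A finite model has finitely many tuples `y`, so the conjunction of one separating formula for
  -- each isolates the type of `x`.
  have hsep : ∀ y : α → M, ∃ φ : L.Formula α, φ.Realize x ∧
      (φ.Realize y → ∀ ψ : L.Formula α, ψ.Realize x → ψ.Realize y) := by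
    intro y
    by_cases h : ∀ ψ : L.Formula α, ψ.Realize x → ψ.Realize y
    · exact ⟨⊤, BoundedFormula.realize_top.2 trivial, fun _ => h⟩
    · push Not at h
      obtain ⟨ψ, h₁, h₂⟩ := h
      exact ⟨ψ, h₁, fun h => (h₂ h).elim⟩
  choose f hf₁ hf₂ using hsep
  refine ⟨Formula.iInf f, fun φ => ?_, Formula.realize_iInf.2 hf₁⟩
  have key : ∀ ψ : L.Formula α, ψ.Realize x → Formula.iInf f ⟹[T] ψ := fun ψ hψ =>
    hT.imp_of_forall_realize M fun y hy => hf₂ y (Formula.realize_iInf.1 hy y) ψ hψ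
  by_cases hφ : φ.Realize x
  · exact Or.inl (key _ hφ)
  · exact Or.inr (key _ (Formula.realize_not.2 hφ))

/-- Every finite tuple in an infinite model of a theory in a countable language has the type of a
tuple in a countable model. -/
theorem exists_card_eq_aleph0_realizing [Countable L.Symbols] (M : ModelType.{u, v, max u v} T)
    [Infinite M] {n : ℕ} (x : Fin n → M) :
    ∃ (N : ModelType.{u, v, max u v} T) (y : Fin n → N), #N = ℵ₀ ∧
      ∀ φ : L.Formula (Fin n), φ.Realize y ↔ φ.Realize x := by
  obtain ⟨S, hS, hcard⟩ := exists_elementarySubstructure_card_eq L (Set.range x) aleph0.{max u v}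
    le_rfl
    (by simp)
    (by simpa only [Cardinal.lift_le_aleph0, Cardinal.lift_aleph0, Language.card] using
      Cardinal.mk_le_aleph0 (α := L.Symbols)) (by simp)
  have hSM : S ⊨ T := inferInstance
  exact ⟨ModelType.of T S, fun i => (⟨x i, hS ⟨i, rfl⟩⟩ : S), by simpa using hcard, fun φ =>
    (S.subtype.map_formula φ _).symm⟩

/-- Isomorphism of countable models in one universe gives isomorphism in every universe. -/
theorem _root_.Cardinal.Categorical.nonempty_equiv (hcat : Cardinal.Categorical.{u, v, w} ℵ₀ T)
    (M N : ModelType.{u, v, max u v} T) (hM : #M = ℵ₀) (hN : #N = ℵ₀) :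
    Nonempty (M ≃[L] N) := by
  have hsmall : ∀ K : ModelType.{u, v, max u v} T, #K = ℵ₀ →
      ∃ K' : ModelType.{u, v, w} T, #K' = ℵ₀ ∧ Nonempty (K ≃[L] K') := by
    intro K hK
    obtain ⟨e⟩ := Cardinal.lift_mk_eq'.{max u v, w}.1
      -- The structure is transported to `ULift ℕ`, in the universe of `hcat`.
      (show Cardinal.lift.{w} #K = Cardinal.lift.{max u v} #(ULift.{w} ℕ) by simp [hK])
    refine ⟨K.equivInduced e, ?_, ⟨e.inducedStructureEquiv⟩⟩
    change #(ULift.{w} ℕ) = ℵ₀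
    simp
  obtain ⟨M', hM', ⟨eM⟩⟩ := hsmall M hM
  obtain ⟨N', hN', ⟨eN⟩⟩ := hsmall N hN
  obtain ⟨e⟩ := hcat M' N' hM' hN'
  exact ⟨(eN.symm.comp e).comp eM⟩

/-- The Ryll-Nardzewski theorem: in a complete `ℵ₀`-categorical theory in a countable language,
finitely many isolating formulas cover all `n`-tuples. -/
theorem IsComplete.exists_finset_isolating [Countable L.Symbols] (hT : T.IsComplete)
    (hcat : Cardinal.Categorical.{u, v, w} ℵ₀ T) (n : ℕ) :
    ∃ A : Finset (L.Formula (Fin n)), (∀ χ ∈ A, T.Isolating χ) ∧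
      ∀ (M : ModelType.{u, v, max u v} T) (x : Fin n → M), ∃ χ ∈ A, χ.Realize x := by
  classical
  by_contra! hcover
  -- Without a finite cover, some tuple `x` satisfies no isolating formula. Its type is omitted in
  -- one countable model and realized in another, against categoricity.
  obtain ⟨M, x, hx⟩ := exists_realize_of_finitely_realized (T := T)
    (BoundedFormula.not '' {χ : L.Formula (Fin n) | T.Isolating χ}) (fun s hs => by
      obtain ⟨A, hA, rfl⟩ := Finset.subset_set_image_iff.1 hs
      obtain ⟨M, x, hx⟩ := hcover A hA
      refine ⟨M, x, fun φ hφ => ?_⟩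
      obtain ⟨χ, hχ, rfl⟩ := Finset.mem_image.1 hφ
      exact Formula.realize_not.2 (hx χ hχ))
  have hxiso : ∀ χ : L.Formula (Fin n), T.Isolating χ → ¬ χ.Realize x := fun χ hχ =>
    Formula.realize_not.1 (hx _ ⟨χ, hχ, rfl⟩)
  have hinf : Infinite M := by
    by_contra hfin
    rw [not_infinite_iff_finite] at hfin
    obtain ⟨χ, hχ, hχx⟩ := hT.exists_isolating_of_finite M x
    exact hxiso χ hχ hχx
  obtain ⟨N, hN, homit⟩ := exists_countable_model_omitting hT.1
    {φ : L.Formula (Fin n) | φ.Realize x} (by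
      intro χ hχ
      by_contra! hall
      have himp : ∀ φ : L.Formula (Fin n), φ.Realize x → χ ⟹[T] φ := fun φ hφ =>
        models_formula_iff.2 fun K y => Formula.realize_imp.2 fun hy => by
          by_contra hnot
          exact hall φ hφ ⟨K, y, Formula.realize_inf.2 ⟨hy, Formula.realize_not.2 hnot⟩⟩
      -- A `χ` implying the whole type of `x` would be isolating, hence false at `x`, and so would
      -- imply its own negation.
      have hiso : T.Isolating χ := fun φ => by
        by_cases hφ : φ.Realize x
        · exact Or.inl (himp φ hφ)
        · exact Or.inr (himp _ (Formula.realize_not.2 hφ))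
      obtain ⟨K, y, hy⟩ := hχ
      have := (himp _ (Formula.realize_not.2 (hxiso χ hiso))).realize_formula K (v := y)
      exact Formula.realize_not.1 (Formula.realize_imp.1 this hy) hy)
  have hNinf : Infinite N := (hT.models_elementarily_equivalent M N).infinite
  obtain ⟨K, y, hK, hy⟩ := exists_card_eq_aleph0_realizing M x
  obtain ⟨e⟩ := hcat.nonempty_equiv K N hK (Cardinal.mk_eq_aleph0 N)
  obtain ⟨φ, hφ, h⟩ := homit (e ∘ y)
  exact h ((StrongHomClass.realize_formula e φ).2 ((hy φ).2 hφ))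

end FirstOrder.Language.Theory

/-! ### Free-variable counts, reductions, and the comparison of the two arities. -/

namespace AlmostArity

open FirstOrder.Language

variable {L : FirstOrder.Language.{u, v}} {T : L.Theory}

theorem varFinsetLeft_restrictVarLeft_subset {α β γ : Type*} [DecidableEq α] [DecidableEq β]
    (t : L.Term (α ⊕ γ)) (f : t.varFinsetLeft → β) :
    (t.restrictVarLeft f).varFinsetLeft ⊆ Finset.univ.image f := by
  induction t with
  | var a =>
    cases a with
    | inl a =>
      simp only [Term.restrictVarLeft, Term.varFinsetLeft, Finset.singleton_subset_iff]
      exact Finset.mem_image_of_mem f (Finset.mem_univ _)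
    | inr a => simp [Term.restrictVarLeft, Term.varFinsetLeft]
  | func F ts ih =>
    simp only [Term.restrictVarLeft, Term.varFinsetLeft, Finset.biUnion_subset]
    refine fun i _ => (ih i _).trans ?_
    rw [Finset.image_subset_iff]
    exact fun x _ => Finset.mem_image_of_mem f (Finset.mem_univ _)

theorem freeVarFinset_restrictFreeVar_subset {α β : Type*} [DecidableEq α] [DecidableEq β]
    {n : ℕ} (φ : L.BoundedFormula α n) (f : φ.freeVarFinset → β) :
    (φ.restrictFreeVar f).freeVarFinset ⊆ Finset.univ.image f := by
  induction φ with
  | falsum => simp [BoundedFormula.restrictFreeVar, BoundedFormula.freeVarFinset]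
  | equal t₁ t₂ =>
    simp only [BoundedFormula.restrictFreeVar, BoundedFormula.freeVarFinset, Finset.union_subset_iff]
    constructor <;>
    · refine (varFinsetLeft_restrictVarLeft_subset _ _).trans ?_
      rw [Finset.image_subset_iff]
      exact fun x _ => Finset.mem_image_of_mem f (Finset.mem_univ _)
  | rel R ts =>
    simp only [BoundedFormula.restrictFreeVar, BoundedFormula.freeVarFinset, Finset.biUnion_subset]
    refine fun i _ => (varFinsetLeft_restrictVarLeft_subset _ _).trans ?_
    rw [Finset.image_subset_iff]
    exact fun x _ => Finset.mem_image_of_mem f (Finset.mem_univ _)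
  | imp φ₁ φ₂ ih₁ ih₂ =>
    simp only [BoundedFormula.restrictFreeVar, BoundedFormula.freeVarFinset, Finset.union_subset_iff]
    refine ⟨(ih₁ _).trans ?_, (ih₂ _).trans ?_⟩ <;>
    · rw [Finset.image_subset_iff]
      exact fun x _ => Finset.mem_image_of_mem f (Finset.mem_univ _)
  | all φ ih => exact ih f

theorem card_freeVarFinset_restrictFreeVar_le {α β : Type*} [DecidableEq α] [DecidableEq β]
    {n : ℕ} (φ : L.BoundedFormula α n) (f : φ.freeVarFinset → β) :
    (φ.restrictFreeVar f).freeVarFinset.card ≤ φ.freeVarFinset.card :=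
  (Finset.card_le_card (freeVarFinset_restrictFreeVar_subset φ f)).trans
    (Finset.card_image_le.trans (by simp))

theorem iff_of_forall_realize {φ ψ : L.Formula ℕ}
    (h : ∀ (M : Theory.ModelType.{u, v, max u v} T) (x : ℕ → M), φ.Realize x ↔ ψ.Realize x) :
    T.Iff φ ψ :=
  Theory.models_formula_iff.2 fun M x => BoundedFormula.realize_iff.2 (h M x)

theorem ReducesTo.trans {Δ Γ : Set (L.Formula ℕ)} {φ : L.Formula ℕ} (hφ : ReducesTo T Δ φ)
    (hΔ : ∀ ψ ∈ Δ, ReducesTo T Γ ψ) : ReducesTo T Γ φ := by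
  obtain ⟨ψ, hψ, e⟩ := hφ
  suffices h : ReducesTo T Γ ψ by
    obtain ⟨χ, hχ, e'⟩ := h
    exact ⟨χ, hχ, e.trans e'⟩
  clear e
  induction hψ with
  | of h => exact hΔ _ h
  | bot => exact ⟨⊥, .bot, Theory.Iff.refl _⟩
  | top => exact ⟨⊤, .top, Theory.Iff.refl _⟩
  | not _ ih =>
    obtain ⟨χ, hχ, e⟩ := ih
    exact ⟨_, .not hχ, e.not⟩
  | and _ _ ih₁ ih₂ =>
    obtain ⟨χ₁, hχ₁, e₁⟩ := ih₁
    obtain ⟨χ₂, hχ₂, e₂⟩ := ih₂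
    refine ⟨_, .and hχ₁ hχ₂, iff_of_forall_realize fun M x => ?_⟩
    rw [Formula.realize_inf, Formula.realize_inf, e₁.realize_iff, e₂.realize_iff]
  | or _ _ ih₁ ih₂ =>
    obtain ⟨χ₁, hχ₁, e₁⟩ := ih₁
    obtain ⟨χ₂, hχ₂, e₂⟩ := ih₂
    refine ⟨_, .or hχ₁ hχ₂, iff_of_forall_realize fun M x => ?_⟩
    rw [Formula.realize_sup, Formula.realize_sup, e₁.realize_iff, e₂.realize_iff]

theorem ReducesTo.of_mem_of_iff {Δ : Set (L.Formula ℕ)} {φ ψ : L.Formula ℕ} (hψ : ψ ∈ Δ)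
    (e : T.Iff φ ψ) : ReducesTo T Δ φ :=
  ⟨ψ, .of hψ, e⟩

theorem ReducesTo.of_iff_exists_mem {ι : Type*} {Δ : Set (L.Formula ℕ)} {φ : L.Formula ℕ}
    (s : Finset ι) (f : ι → L.Formula ℕ) (hs : ∀ i ∈ s, f i ∈ Δ)
    (h : ∀ (M : Theory.ModelType.{u, v, max u v} T) (x : ℕ → M),
      φ.Realize x ↔ ∃ i ∈ s, (f i).Realize x) : ReducesTo T Δ φ := by
  classical
  suffices hsup : ∃ ψ, BoolComb Δ ψ ∧ ∀ (M : Theory.ModelType.{u, v, max u v} T) (x : ℕ → M),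
      ψ.Realize x ↔ ∃ i ∈ s, (f i).Realize x by
    obtain ⟨ψ, hψ, hiff⟩ := hsup
    exact ⟨ψ, hψ, iff_of_forall_realize fun M x => (h M x).trans (hiff M x).symm⟩
  clear h
  induction s using Finset.induction_on with
  | empty => exact ⟨⊥, .bot, fun M x => by simp [Formula.Realize]⟩
  | insert i s _ ih =>
    obtain ⟨ψ, hψ, hiff⟩ := ih fun j hj => hs j (Finset.mem_insert_of_mem hj)
    refine ⟨f i ⊔ ψ, .or (.of (hs i (Finset.mem_insert_self _ _))) hψ, fun M x => ?_⟩
    rw [Formula.realize_sup, hiff, Finset.exists_mem_insert]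

/-- An almost `n`-ary theory is `m`-ary for some `m`. -/
theorem IsAlmostNAry.exists_isNAry {n : ℕ} (h : IsAlmostNAry T n) :
    ∃ m : ℕ, 1 ≤ m ∧ IsNAry T m := by
  obtain ⟨W, hW⟩ := h
  let k := W.sup fun φ => (BoundedFormula.freeVarFinset φ).card
  -- This bounds both `n` and `k`; the `2` avoids the special clause for arity one.
  refine ⟨n + k + 2, by omega, ?_⟩
  simp only [IsNAry, show n + k + 2 ≠ 1 by omega, if_false]
  refine fun φ => (hW φ).trans ?_
  rintro ψ (hψ | ⟨φ, hφ, σ, rfl⟩)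
  · exact hψ.trans fun χ hχ => .of_mem_of_iff
      (show χ ∈ formulasOfArity L (n + k + 2) from le_trans (b := n) hχ (by omega)) (Theory.Iff.refl _)
  · refine .of_mem_of_iff (ψ := φ.restrictFreeVar fun a => σ a) ?_
      (iff_of_forall_realize fun M x => ?_)
    · have h₁ := card_freeVarFinset_restrictFreeVar_le φ fun a => σ a
      have h₂ : (BoundedFormula.freeVarFinset φ).card ≤ k :=
        Finset.le_sup (f := fun φ : L.Formula ℕ => (BoundedFormula.freeVarFinset φ).card) hφ
      exact h₁.trans (by omega)
    · rw [Formula.realize_relabel]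
      exact (BoundedFormula.realize_restrictFreeVar (v := x) (x ∘ σ) fun _ => rfl).symm

/-- An `ℵ₀`-categorical theory which is `m`-ary for some `m` is almost unary. -/
theorem IsNAry.isAlmostNAry_one [Countable L.Symbols] (hT : T.IsComplete)
    (hcat : Cardinal.Categorical.{u, v, w} ℵ₀ T) {m : ℕ} (hm : 1 ≤ m) (h : IsNAry T m) :
    IsAlmostNAry T 1 := by
  classical
  -- Passing to `m + 1 ≥ 2` absorbs the equalities of the unary case.
  have h' := h.mono hm (Nat.le_succ m)
  simp only [IsNAry, show m.succ ≠ 1 by omega, if_false] at h'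
  obtain ⟨A, hA, hcover⟩ := hT.exists_finset_isolating hcat m.succ
  refine ⟨A.image fun χ => Formula.relabel Fin.val χ, fun φ => (h' φ).trans fun ψ hψ => ?_⟩
  obtain ⟨f⟩ : Nonempty (BoundedFormula.freeVarFinset ψ ↪ Fin m.succ) := by
    rw [Function.Embedding.nonempty_iff_card_le]
    simpa using show (BoundedFormula.freeVarFinset ψ).card ≤ m.succ from hψ
  let ψ' : L.Formula (Fin m.succ) := ψ.restrictFreeVar f
  -- Slots not used by `ψ` are filled with the variable `0`; the cover applies to the padded tuple
  -- too.
  let τ : Fin m.succ → ℕ := Function.extend f Subtype.val fun _ => 0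
  have hψ' : ∀ (M : Theory.ModelType.{u, v, max u v} T) (x : ℕ → M),
      ψ'.Realize (x ∘ τ) ↔ ψ.Realize x := fun M x =>
    BoundedFormula.realize_restrictFreeVar x fun a =>
      congrArg x (f.injective.extend_apply _ _ a)
  let σ : ℕ → ℕ := Function.extend Fin.val τ fun _ => 0
  have hσ : σ ∘ (Fin.val : Fin m.succ → ℕ) = τ :=
    funext fun i => Fin.val_injective.extend_apply τ (fun _ => 0) i
  have hrelabel : ∀ (χ : L.Formula (Fin m.succ)) (M : Theory.ModelType.{u, v, max u v} T)
      (x : ℕ → M), (Formula.relabel σ (Formula.relabel Fin.val χ)).Realize x ↔ χ.Realize (x ∘ τ) := by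
    intro χ M x
    rw [Formula.realize_relabel, Formula.realize_relabel, Function.comp_assoc, hσ]
  -- `ψ` is the disjunction of the instances of those isolating formulas that imply `ψ'`.
  refine .of_iff_exists_mem (A.filter fun χ => χ ⟹[T] ψ')
    (fun χ => Formula.relabel σ (Formula.relabel Fin.val χ)) (fun χ hχ => Or.inr ⟨Formula.relabel Fin.val χ, ?_, σ, rfl⟩)
    fun M x => ?_
  · exact Finset.mem_coe.2 (Finset.mem_image_of_mem _ (Finset.mem_filter.1 hχ).1)
  · simp only [hrelabel, ← hψ' M x, Finset.mem_filter]
    constructor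
    · intro hx
      obtain ⟨χ, hχ, hχx⟩ := hcover M (x ∘ τ)
      refine ⟨χ, ⟨hχ, (hA χ hχ ψ').resolve_right fun himp => ?_⟩, hχx⟩
      exact Formula.realize_not.1 (Formula.realize_imp.1 (himp.realize_formula M) hχx) hx
    · rintro ⟨χ, ⟨-, himp⟩, hχx⟩
      exact Formula.realize_imp.1 (himp.realize_formula M) hχx

end AlmostArity

theorem mainTheorem7 {L : FirstOrder.Language.{u, v}} [Countable L.Symbols] (T : L.Theory)
    (hT : T.IsComplete) (hcat : Cardinal.Categorical.{u, v, w} ℵ₀ T) :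
    (AlmostArity.aar T = 1 ∧ ∃ n : ℕ, AlmostArity.ar T = n) ∨
      (AlmostArity.aar T = ⊤ ∧ AlmostArity.ar T = ⊤) := by
  by_cases h : ∃ m : ℕ, 1 ≤ m ∧ AlmostArity.IsNAry T m
  · obtain ⟨m, hm, hmT⟩ := h
    refine Or.inl ⟨le_antisymm (sInf_le ⟨1, rfl, le_rfl, hmT.isAlmostNAry_one hT hcat hm⟩) ?_, ?_⟩
    · refine le_sInf ?_
      rintro _ ⟨n, rfl, hn, -⟩
      exact_mod_cast hn
    · have hle : AlmostArity.ar T ≤ m := sInf_le ⟨m, rfl, hm, hmT⟩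
      obtain ⟨n, hn⟩ := ENat.ne_top_iff_exists.1 (ne_top_of_le_ne_top (ENat.natCast_ne_top m) hle)
      exact ⟨n, hn.symm⟩
  · refine Or.inr ⟨sInf_eq_top.2 ?_, sInf_eq_top.2 ?_⟩
    · rintro _ ⟨n, -, -, hn⟩
      exact (h hn.exists_isNAry).elim
    · rintro _ ⟨n, -, hn, hnT⟩
      exact (h ⟨n, hn, hnT⟩).elim
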